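/- Let $M=(E,\mathcal I)$ be a matroid of rank $2$ on a finite ground set $E$, and let $t\ge 1$ be an integer. A basis of $M$ is rainbow with respect to a coloring of $E$ if its elements receive pairwise different colors. Let $ar(M,t)$ be the maximum number $m$ such that there is a coloring of $E$ using exactly $m$ colors for which $M$ contains no $t$ pairwise disjoint rainbow bases. Let $M_0$ be the set of loops (rank-$0$ elements) of $M$, and for $x\in E$ let $cl(x)$ be the closure of $\{x\}$ in $M$. Then $$ ar(M,t)=\begin{cases} |E| & \text{if } |E|<|M_0|+2t \text{ or } |E|<|cl(x)|+t \text{ for some } x\in E,\\ |M_0|+t & \text{otherwise.} \end{cases} $$ In particular, the maximum defining $ar(M,t)$ exists. -/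

import Mathlib

/-- The colouring `c` of the elements of `M` admits `t` pairwise disjoint rainbow bases: bases
`B 0, …, B (t - 1)` of `M`, pairwise disjoint, in each of which all elements receive different
colours. -/
def Matroid.HasDisjointRainbowBases {α : Type*} (M : Matroid α) (c : α → ℕ) (t : ℕ) : Prop :=
  ∃ B : Fin t → Set α,
    (∀ i, M.IsBase (B i) ∧ Set.InjOn c (B i)) ∧ ∀ i j, i ≠ j → Disjoint (B i) (B j)

/-- `m` is the anti-Ramsey number `ar(M, t)`: the largest number `m` such that the ground set of
`M` has a colouring using exactly `m` colours without `t` pairwise disjoint rainbow bases.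
Only the colours `c e` with `e ∈ M.E` matter; as the ground sets considered are finite, natural
numbers are enough as colours. -/
def Matroid.IsAntiRamseyNumber {α : Type*} (M : Matroid α) (t m : ℕ) : Prop :=
  IsGreatest {k : ℕ | ∃ c : α → ℕ, (c '' M.E).ncard = k ∧ ¬ M.HasDisjointRainbowBases c t} m

/-!
Two non-loops of a rank-two matroid form a basis exactly when they span different closures. So
disjoint bases are matchings of the complete multipartite graph on the non-loops whose parts are
the parallel classes, and `t` disjoint bases force `2 * t` non-loops and `t` elements outside every
`cl(x)`. When one of these bounds fails, the colouring in which all colours differ is extremal.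

Otherwise the lower bound comes from giving the loops and `t - 1` non-loops private colours and
all other non-loops one common colour: each rainbow basis uses one of the `t - 1` special elements.

The upper bound is `exists_disjoint_rainbow_pairs`: if at least `2 * t` points are partitioned into
classes, each missing at least `t` points, and carry at least `t + 1` colours, then there are `t`
disjoint pairs that differ in both class and colour. It is proved by induction on `t`, removing one
pair. The pair has to meet every class that misses exactly `t` points and, for `t > 1`, may not
take the last elements of two colours unless there is a colour to spare;
`exists_removable_pair` finds it.
* If a class misses exactly `t` points, some colour occurs only inside that class; one end of the
  pair is taken of this colour and the other outside the class.
* If no class is that large, only the colours obstruct. If they obstructed every pair, some two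
  elements of different classes would each agree in colour with everything outside their own
  class, leaving one colour in all.
-/

/-! ### Disjoint rainbow pairs in a partitioned set -/

open Finset in
theorem card_image_le_card_image_sdiff_pair {α : Type*} [DecidableEq α] (S : Finset α) (c : α → ℕ)
    (x y : α) : #(S.image c) ≤ #((S \ {x, y}).image c) + 2 := by
  have h : S.image c ⊆ insert (c x) (insert (c y) ((S \ {x, y}).image c)) := by
    intro k hk
    obtain ⟨w, hw, rfl⟩ := mem_image.1 hk
    by_cases h1 : w = x
    · simp [h1]
    by_cases h2 : w = y
    · simp [h2]
    have : c w ∈ (S \ {x, y}).image c := mem_image_of_mem _ (by simp [hw, h1, h2])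
    simp only [mem_insert, this, or_true]
  have h3 := card_le_card h
  have h4 := card_insert_le (c x) (insert (c y) ((S \ {x, y}).image c))
  have h5 := card_insert_le (c y) ((S \ {x, y}).image c)
  omega

open Finset in
/-- Removing a pair loses at most one colour if one of its colours survives on some `w`. -/
theorem card_image_le_card_image_sdiff_pair_of_eq {α : Type*} [DecidableEq α] {S : Finset α}
    {c : α → ℕ} {x y w : α} (hw : w ∈ S) (hwx : w ≠ x) (hwy : w ≠ y) (hc : c w = c x ∨ c w = c y) :
    #(S.image c) ≤ #((S \ {x, y}).image c) + 1 := by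
  have hcw : c w ∈ (S \ {x, y}).image c := mem_image_of_mem _ (by simp [hw, hwx, hwy])
  have h : ∃ k, S.image c ⊆ insert k ((S \ {x, y}).image c) := by
    refine ⟨if c w = c x then c y else c x, fun k hk ↦ ?_⟩
    obtain ⟨u, hu, rfl⟩ := mem_image.1 hk
    by_cases h1 : u = x
    · subst h1
      split_ifs with h
      · exact mem_insert_of_mem (h ▸ hcw)
      · exact mem_insert_self _ _
    by_cases h2 : u = y
    · subst h2
      split_ifs with h
      · exact mem_insert_self _ _
      · exact mem_insert_of_mem (hc.resolve_left h ▸ hcw)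
    exact mem_insert_of_mem (mem_image_of_mem _ (by simp [hu, h1, h2]))
  obtain ⟨k, h⟩ := h
  exact (card_le_card h).trans (card_insert_le _ _)

open Finset in
/-- The case of the induction step in which the class of `z₀` misses exactly `t` points. -/
theorem exists_removable_pair_of_card_eq {α β : Type*} [DecidableEq α] [DecidableEq β]
    {S : Finset α} {r : α → β} {c : α → ℕ} {t : ℕ} (ht : 1 ≤ t) (hS : 2 * t ≤ #S)
    (hc : t + 1 ≤ #(S.image c)) {z₀ : α} (h₀ : #{y ∈ S | r y ≠ r z₀} = t) :
    ∃ x ∈ S, ∃ y ∈ S, r x ≠ r y ∧ c x ≠ c y ∧ (1 < t → t ≤ #((S \ {x, y}).image c)) ∧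
      ∀ z ∈ S, #{w ∈ S | r w ≠ r z} = t → r x = r z ∨ r y = r z := by
  set T : Finset α := {y ∈ S | r y ≠ r z₀} with hT
  set R : Finset α := {y ∈ S | r y = r z₀} with hR
  have hRT : #R + #T = #S := card_filter_add_card_filter_not _
  -- The `t` points of `T` cannot carry all colours, so some colour lives on `R` alone.
  obtain ⟨x, hxS, hxT⟩ : ∃ x ∈ S, c x ∉ T.image c := by
    by_contra! h
    have h1 : S.image c ⊆ T.image c := fun k hk ↦ by
      obtain ⟨w, hw, rfl⟩ := mem_image.1 hk
      exact h w hw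
    have h2 := card_le_card h1
    have h3 := card_image_le (s := T) (f := c)
    omega
  have hxr : r x = r z₀ := by
    by_contra h
    exact hxT (mem_image_of_mem _ (by simp [hT, hxS, h]))
  have hcol : ∀ y ∈ T, c x ≠ c y := fun y hy h ↦ hxT (h ▸ mem_image_of_mem _ hy)
  suffices h : ∃ y ∈ T, 1 < t → t ≤ #((S \ {x, y}).image c) by
    obtain ⟨y, hyT, hy⟩ := h
    have hyS : y ∈ S := (mem_filter.1 hyT).1
    have hyr : r y ≠ r z₀ := (mem_filter.1 hyT).2
    refine ⟨x, hxS, y, hyS, hxr ▸ hyr.symm, hcol y hyT, hy, fun z hz hzt ↦ ?_⟩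
    by_contra! hne
    -- Two classes missing exactly `t` of at least `2 * t` points cover everything.
    have hsub : insert y R ⊆ {w ∈ S | r w ≠ r z} := by
      intro w hw
      rcases mem_insert.1 hw with rfl | hw
      · simp [hyS, hne.2]
      · have := mem_filter.1 hw
        simp [this.1, this.2, ← hxr, hne.1]
    have h1 := card_le_card hsub
    rw [card_insert_of_notMem (by simp [hR, hyr])] at h1
    omega
  by_cases hrep : ∃ y ∈ T, ∃ w ∈ S, w ≠ x ∧ w ≠ y ∧ (c w = c x ∨ c w = c y)
  · obtain ⟨y, hy, w, hw, hwx, hwy, hcw⟩ := hrep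
    have := card_image_le_card_image_sdiff_pair_of_eq hw hwx hwy hcw
    exact ⟨y, hy, fun _ ↦ by omega⟩
  · push Not at hrep
    obtain ⟨y, hy⟩ : T.Nonempty := card_pos.1 (by omega)
    refine ⟨y, hy, fun h1 ↦ ?_⟩
    -- All colours on `T` occur once, and a second element `w` of `R` contributes another colour.
    obtain ⟨w, hwR, hwx⟩ : ∃ w ∈ R, w ≠ x := exists_mem_ne (by omega) x
    have hwS : w ∈ S := (mem_filter.1 hwR).1
    have hwT : w ∉ T := fun h ↦ (mem_filter.1 h).2 (mem_filter.1 hwR).2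
    have hxnT : x ∉ T := fun h ↦ (mem_filter.1 h).2 hxr
    have hTne : ∀ u ∈ T, ∀ v ∈ S, v ≠ x → v ≠ u → c v ≠ c u :=
      fun u hu v hv hvx hvu ↦ (hrep u hu v hv hvx hvu).2
    have hinj : Set.InjOn c (insert w (T.erase y) : Finset α) := by
      intro u hu v hv huv
      simp only [coe_insert, coe_erase, Set.mem_insert_iff, Set.mem_sdiff, mem_coe] at hu hv
      by_contra hne
      rcases hu with rfl | hu
      · rcases hv with rfl | hv
        · exact hne rfl
        · exact hTne v hv.1 u hwS hwx hne huv
      · rcases hv with rfl | hv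
        · exact hTne u hu.1 v hwS hwx (Ne.symm hne) huv.symm
        · exact hTne v hv.1 u (mem_filter.1 hu.1).1 (fun h ↦ hxnT (h ▸ hu.1)) hne huv
    have hsub : insert w (T.erase y) ⊆ S \ {x, y} := by
      intro u hu
      rcases mem_insert.1 hu with rfl | hu
      · have : u ≠ y := fun h ↦ hwT (h ▸ hy)
        simp [hwS, hwx, this]
      · have h2 := mem_erase.1 hu
        have : u ≠ x := fun h ↦ hxnT (h ▸ h2.2)
        simp [(mem_filter.1 h2.2).1, this, h2.1]
    have h2 := card_le_card (image_subset_image (f := c) hsub)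
    rw [card_image_of_injOn hinj, card_insert_of_notMem (fun h ↦ hwT (mem_of_mem_erase h)),
      card_erase_of_mem hy] at h2
    omega

open Finset in
/-- A pair that differs in class and colour and whose removal preserves the hypotheses of
`exists_disjoint_rainbow_pairs` with `t - 1` in place of `t`. -/
theorem exists_removable_pair {α β : Type*} [DecidableEq α] [DecidableEq β] {S : Finset α}
    {r : α → β} {c : α → ℕ} {t : ℕ} (ht : 1 ≤ t) (hS : 2 * t ≤ #S)
    (hr : ∀ x ∈ S, t ≤ #{y ∈ S | r y ≠ r x}) (hc : t + 1 ≤ #(S.image c)) :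
    ∃ x ∈ S, ∃ y ∈ S, r x ≠ r y ∧ c x ≠ c y ∧ (1 < t → t ≤ #((S \ {x, y}).image c)) ∧
      ∀ z ∈ S, #{w ∈ S | r w ≠ r z} = t → r x = r z ∨ r y = r z := by
  by_cases hz : ∃ z ∈ S, #{w ∈ S | r w ≠ r z} = t
  · obtain ⟨z, -, hz⟩ := hz
    exact exists_removable_pair_of_card_eq ht hS hc hz
  push Not at hz
  by_contra! hcon
  have hbad : ∀ x ∈ S, ∀ y ∈ S, r x ≠ r y → c x ≠ c y →
      1 < t ∧ #((S \ {x, y}).image c) < t := by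
    intro x hx y hy hxy hcxy
    by_contra h
    obtain ⟨z, hzS, hzt, -⟩ := hcon x hx y hy hxy hcxy fun h1 ↦ by
      by_contra h2
      exact h ⟨h1, by omega⟩
    exact hz z hzS hzt
  -- An element whose colour repeats agrees in colour with everything outside its class.
  have hrep : ∀ z ∈ S, ∀ w ∈ S, z ≠ w → c z = c w → ∀ y ∈ S, r z ≠ r y → c z = c y := by
    intro z hzS w hw hzw hcz y hy hrzy
    by_contra hne
    have h1 := hbad z hzS y hy hrzy hne
    have h2 := card_image_le_card_image_sdiff_pair_of_eq (y := y) hw hzw.symm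
      (fun h ↦ hne (by rw [hcz, h])) (Or.inl hcz.symm)
    omega
  have hout : ∀ z ∈ S, ∃ y ∈ S, r z ≠ r y := by
    intro z hzS
    obtain ⟨y, hy⟩ : ({y ∈ S | r y ≠ r z} : Finset α).Nonempty :=
      card_pos.1 (by have := hr z hzS; omega)
    exact ⟨y, (mem_filter.1 hy).1, (mem_filter.1 hy).2.symm⟩
  obtain ⟨z, hzS, hzall⟩ : ∃ z ∈ S, ∀ y ∈ S, r z ≠ r y → c z = c y := by
    by_cases hlt : #(S.image c) < #S
    · obtain ⟨z, hzS, w, hw, hzw, hcz⟩ :=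
        exists_ne_map_eq_of_card_lt_of_maps_to hlt (fun x hx ↦ mem_image_of_mem c hx)
      exact ⟨z, hzS, hrep z hzS w hw hzw hcz⟩
    · -- If all colours are distinct and `t > 1`, then two of them can be spared.
      obtain ⟨z, hzS⟩ : S.Nonempty := card_pos.1 (by omega)
      refine ⟨z, hzS, fun y hy hry ↦ ?_⟩
      by_contra hne
      have h1 := hbad z hzS y hy hry hne
      have h2 := card_image_le_card_image_sdiff_pair S c z y
      omega
  -- Now `y` shares its colour with `z`, so the same holds for `y`, and `c` is constant on `S`.
  obtain ⟨y, hy, hry⟩ := hout z hzS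
  have hcy := hzall y hy hry
  have hsub : S.image c ⊆ {c z} := by
    intro k hk
    obtain ⟨u, hu, rfl⟩ := mem_image.1 hk
    by_cases hu' : r z = r u
    · have := hrep y hy z hzS (fun h ↦ hry (by rw [h])) hcy.symm u hu (hu' ▸ hry.symm)
      simp [← this, hcy]
    · simp [hzall u hu hu']
  have := card_le_card hsub
  rw [card_singleton] at this
  omega

open Finset in
/-- For `t = 0` no colours are required: the hypothesis on colours is conditional so that the
induction may remove the last colours together with the last pair. -/
theorem exists_disjoint_rainbow_pairs {α β : Type*} [DecidableEq α] [DecidableEq β] (r : α → β)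
    (c : α → ℕ) (t : ℕ) : ∀ S : Finset α, 2 * t ≤ #S → (∀ x ∈ S, t ≤ #{y ∈ S | r y ≠ r x}) →
    (0 < t → t + 1 ≤ #(S.image c)) →
    ∃ x y : Fin t → α, (∀ i, x i ∈ S ∧ y i ∈ S ∧ r (x i) ≠ r (y i) ∧ c (x i) ≠ c (y i)) ∧
      ∀ i j, i ≠ j → Disjoint ({x i, y i} : Set α) {x j, y j} := by
  induction t with
  | zero => exact fun S _ _ _ ↦ ⟨Fin.elim0, Fin.elim0, fun i ↦ i.elim0, fun i ↦ i.elim0⟩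
  | succ t ih =>
    intro S hS hr hc
    obtain ⟨a, ha, b, hb, hrab, hcab, hcol, htight⟩ :=
      exists_removable_pair (Nat.succ_pos t) hS hr (hc (Nat.succ_pos t))
    have hS' : 2 * t ≤ #(S \ {a, b}) := by
      have := le_card_sdiff {a, b} S
      have := card_le_two (a := a) (b := b)
      omega
    have hr' : ∀ x ∈ S \ {a, b}, t ≤ #{y ∈ S \ {a, b} | r y ≠ r x} := by
      intro z hz
      have hzS := sdiff_subset hz
      have hle := hr z hzS
      have hfil : ({y ∈ S \ {a, b} | r y ≠ r z} : Finset α) = {y ∈ S | r y ≠ r z} \ {a, b} := by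
        ext u
        simp only [mem_filter, mem_sdiff]
        tauto
      rw [hfil]
      by_cases heq : #{w ∈ S | r w ≠ r z} = t + 1
      · -- One end of the pair lies in the class of `z`, so only the other end is lost here.
        rcases htight z hzS heq with h | h
        · have h1 : ({y ∈ S | r y ≠ r z} : Finset α).erase b ⊆ {y ∈ S | r y ≠ r z} \ {a, b} := by
            intro u hu
            have hu' := mem_erase.1 hu
            have : u ≠ a := fun h' ↦ (mem_filter.1 hu'.2).2 (h' ▸ h)
            simp only [mem_sdiff, mem_insert, mem_singleton, this, hu'.1, hu'.2]
            simp
          have := card_le_card h1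
          have := pred_card_le_card_erase (s := {y ∈ S | r y ≠ r z}) (a := b)
          omega
        · have h1 : ({y ∈ S | r y ≠ r z} : Finset α).erase a ⊆ {y ∈ S | r y ≠ r z} \ {a, b} := by
            intro u hu
            have hu' := mem_erase.1 hu
            have : u ≠ b := fun h' ↦ (mem_filter.1 hu'.2).2 (h' ▸ h)
            simp only [mem_sdiff, mem_insert, mem_singleton, this, hu'.1, hu'.2]
            simp
          have := card_le_card h1
          have := pred_card_le_card_erase (s := {y ∈ S | r y ≠ r z}) (a := a)
          omega
      · have := le_card_sdiff {a, b} {y ∈ S | r y ≠ r z}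
        have := card_le_two (a := a) (b := b)
        omega
    obtain ⟨x, y, hxy, hdis⟩ := ih (S \ {a, b}) hS' hr' fun h ↦ hcol (by omega)
    have hd : ∀ i, Disjoint ({a, b} : Set α) {x i, y i} := by
      intro i
      have h1 := (hxy i).1
      have h2 := (hxy i).2.1
      simp only [mem_sdiff, mem_insert, mem_singleton, not_or] at h1 h2
      simp only [Set.disjoint_insert_left, Set.disjoint_singleton_left, Set.mem_insert_iff,
        Set.mem_singleton_iff, not_or]
      exact ⟨⟨Ne.symm h1.2.1, Ne.symm h2.2.1⟩, Ne.symm h1.2.2, Ne.symm h2.2.2⟩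
    refine ⟨Fin.cons a x, Fin.cons b y, fun i ↦ ?_, fun i j ↦ ?_⟩
    · refine Fin.cases ⟨ha, hb, hrab, hcab⟩ (fun i ↦ ?_) i
      exact ⟨sdiff_subset (hxy i).1, sdiff_subset (hxy i).2.1, (hxy i).2.2⟩
    · refine Fin.cases ?_ (fun i ↦ ?_) i <;> refine Fin.cases ?_ (fun j ↦ ?_) j
      · exact fun h ↦ absurd rfl h
      · exact fun _ ↦ hd j
      · exact fun _ ↦ (hd i).symm
      · exact fun h ↦ hdis i j (fun h' ↦ h (by rw [h']))

/-! ### Bases of a matroid of rank two -/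

theorem Matroid.isBase_pair_of_closure_ne {α : Type*} {M : Matroid α} (hM : M.eRank = 2) {x y : α}
    (hx : M.IsNonloop x) (hy : M.IsNonloop y) (hxy : M.closure {x} ≠ M.closure {y}) :
    M.IsBase {x, y} := by
  have hI : M.Indep {x, y} := by
    by_contra h
    refine hxy ((hx.closure_eq_closure_iff_eq_or_dep hy).2 (Or.inr ?_))
    exact h
  have hne : x ≠ y := fun h ↦ hxy (by rw [h])
  refine hI.isBase_of_eRk_ge (Set.toFinite _) ?_
  rw [hM, hI.eRk_eq_encard, Set.encard_pair hne]

theorem Matroid.IsBase.exists_notMem_closure_singleton {α : Type*} {M : Matroid α}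
    (hM : M.eRank = 2) {B : Set α} (hB : M.IsBase B) (x : α) : ∃ y ∈ B, y ∉ M.closure {x} := by
  by_contra! h
  have h1 : M.eRk B ≤ M.eRk {x} := by
    rw [← M.eRk_closure_eq {x}]
    exact M.eRk_mono h
  rw [hB.eRk_eq_eRank, hM] at h1
  have h2 := h1.trans (M.eRk_le_encard {x})
  rw [Set.encard_singleton] at h2
  exact absurd h2 (by decide)

theorem mul_le_ncard_of_pairwise_disjoint {α : Type*} {t k : ℕ} {B : Fin t → Set α} {U : Set α}
    (hU : U.Finite) (hB : ∀ i j, i ≠ j → Disjoint (B i) (B j))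
    (hk : ∀ i, k ≤ (B i ∩ U).ncard) : t * k ≤ U.ncard := by
  classical
  have hfin : ∀ i, (B i ∩ U).Finite := fun i ↦ hU.subset Set.inter_subset_right
  have hsub : Finset.univ.biUnion (fun i ↦ (hfin i).toFinset) ⊆ hU.toFinset := by
    intro x hx
    simp only [Finset.mem_biUnion, Set.Finite.mem_toFinset] at hx ⊢
    obtain ⟨i, -, hi⟩ := hx
    exact hi.2
  have h := Finset.card_le_card hsub
  rw [Finset.card_biUnion, ← Set.ncard_eq_toFinset_card U hU] at h
  · refine le_trans ?_ h
    have := Finset.card_nsmul_le_sum Finset.univ (fun i ↦ (hfin i).toFinset.card) k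
      (fun i _ ↦ by rw [← Set.ncard_eq_toFinset_card _ (hfin i)]; exact hk i)
    simpa using this
  · intro i _ j _ hij
    simpa [Set.disjoint_iff_inter_eq_empty] using
      (hB i j hij).mono Set.inter_subset_left Set.inter_subset_left

theorem Matroid.HasDisjointRainbowBases.le_ncard {α : Type*} {M : Matroid α} [M.Finite]
    (hM : M.eRank = 2) {c : α → ℕ} {t : ℕ} (h : M.HasDisjointRainbowBases c t) :
    M.loops.ncard + 2 * t ≤ M.E.ncard ∧ ∀ x, (M.closure {x}).ncard + t ≤ M.E.ncard := by
  obtain ⟨B, hB, hdis⟩ := h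
  have hE := M.ground_finite
  constructor
  · have h1 := mul_le_ncard_of_pairwise_disjoint (k := 2) (U := M.E \ M.loops) hE.sdiff hdis
      (fun i ↦ by
        have hsub : B i ⊆ M.E \ M.loops := Set.subset_sdiff.2
          ⟨(hB i).1.subset_ground, (hB i).1.indep.disjoint_loops⟩
        rw [Set.inter_eq_left.2 hsub, Set.ncard, (hB i).1.encard_eq_eRank, hM]
        rfl)
    have h2 := Set.ncard_sdiff_add_ncard_of_subset M.loops_subset_ground hE
    omega
  · intro x
    have h1 := mul_le_ncard_of_pairwise_disjoint (k := 1) (U := M.E \ M.closure {x}) hE.sdiff hdis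
      (fun i ↦ by
        obtain ⟨y, hyB, hy⟩ := (hB i).1.exists_notMem_closure_singleton hM x
        exact (Set.ncard_pos (hE.sdiff.subset Set.inter_subset_right)).2
          ⟨y, hyB, (hB i).1.subset_ground hyB, hy⟩)
    have h2 := Set.ncard_sdiff_add_ncard_of_subset (M.closure_subset_ground {x}) hE
    omega

/-! ### The two bounds -/

theorem Matroid.hasDisjointRainbowBases_of_lt_ncard {α : Type*} {M : Matroid α} [M.Finite]
    (hM : M.eRank = 2) {c : α → ℕ} {t : ℕ} (hE : M.loops.ncard + 2 * t ≤ M.E.ncard)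
    (hcl : ∀ x ∈ M.E, (M.closure {x}).ncard + t ≤ M.E.ncard)
    (hc : M.loops.ncard + t < (c '' M.E).ncard) : M.HasDisjointRainbowBases c t := by
  classical
  have hfin := M.ground_finite
  have hNfin : (M.E \ M.loops).Finite := hfin.sdiff
  have hN : ∀ x, x ∈ hNfin.toFinset ↔ M.IsNonloop x := fun x ↦ by
    rw [Set.Finite.mem_toFinset, Matroid.isNonloop_iff_mem_compl_loops]
  have hNcard : hNfin.toFinset.card + M.loops.ncard = M.E.ncard := by
    rw [← Set.ncard_eq_toFinset_card _ hNfin]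
    exact Set.ncard_sdiff_add_ncard_of_subset M.loops_subset_ground hfin
  have hr : ∀ x ∈ hNfin.toFinset,
      t ≤ (hNfin.toFinset.filter (fun y ↦ M.closure {y} ≠ M.closure {x})).card := by
    intro x hx
    have hxn := (hN x).1 hx
    have h1 := hcl x hxn.mem_ground
    have h2 := Set.ncard_sdiff_add_ncard_of_subset (M.closure_subset_ground {x}) hfin
    have h3 : (M.E \ M.closure {x}).ncard ≤
        (hNfin.toFinset.filter (fun y ↦ M.closure {y} ≠ M.closure {x})).card := by
      rw [← Set.ncard_coe_finset]
      refine Set.ncard_le_ncard (fun y hy ↦ ?_) (Finset.finite_toSet _)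
      have hyn := Matroid.isNonloop_of_notMem_closure hy.2 hy.1
      simp only [Finset.coe_filter, Set.mem_ofPred]
      exact ⟨(hN y).2 hyn, fun h ↦ hy.2 (h ▸ M.mem_closure_self y hy.1)⟩
    omega
  have hcol : t + 1 ≤ (hNfin.toFinset.image c).card := by
    have h1 : c '' M.E ⊆ c '' M.loops ∪ c '' (M.E \ M.loops) := by
      rw [← Set.image_union, Set.union_sdiff_cancel M.loops_subset_ground]
    have hLfin := hfin.subset M.loops_subset_ground
    have h2 := (Set.ncard_le_ncard h1 ((hLfin.image c).union (hNfin.image c))).trans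
      (Set.ncard_union_le _ _)
    have h3 := Set.ncard_image_le (f := c) hLfin
    have h4 : (c '' (M.E \ M.loops)).ncard = (hNfin.toFinset.image c).card := by
      rw [← Set.ncard_coe_finset, Finset.coe_image, Set.Finite.coe_toFinset]
    omega
  obtain ⟨x, y, hxy, hdis⟩ := exists_disjoint_rainbow_pairs (fun x ↦ M.closure {x}) c t
    hNfin.toFinset (by omega) hr fun _ ↦ hcol
  refine ⟨fun i ↦ {x i, y i}, fun i ↦ ?_, hdis⟩
  obtain ⟨hx, hy, hr, hcxy⟩ := hxy i
  refine ⟨Matroid.isBase_pair_of_closure_ne hM ((hN _).1 hx) ((hN _).1 hy) hr, ?_⟩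
  rw [Set.injOn_pair]
  exact fun h ↦ absurd h hcxy

theorem Matroid.exists_not_hasDisjointRainbowBases {α : Type*} {M : Matroid α} [M.Finite]
    (hM : M.eRank = 2) {t : ℕ} (ht : 1 ≤ t) (hE : M.loops.ncard + t ≤ M.E.ncard) :
    ∃ c : α → ℕ, (c '' M.E).ncard = M.loops.ncard + t ∧ ¬ M.HasDisjointRainbowBases c t := by
  classical
  have hfin := M.ground_finite
  have hLfin := hfin.subset M.loops_subset_ground
  obtain ⟨f, hf⟩ := Set.countable_iff_exists_injOn.1 hfin.countable
  have h1 := Set.ncard_sdiff_add_ncard_of_subset M.loops_subset_ground hfin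
  obtain ⟨T, hTsub, hT⟩ := Set.exists_subset_card_eq (s := M.E \ M.loops) (n := t) (by omega)
  have hTE : T ⊆ M.E := hTsub.trans Set.sdiff_subset
  have hTfin := hfin.subset hTE
  obtain ⟨e, he⟩ : T.Nonempty := (Set.ncard_pos hTfin).1 (by omega)
  have hsub : M.loops ∪ T ⊆ M.E := Set.union_subset M.loops_subset_ground hTE
  -- The elements outside `M.loops ∪ T` share the colour of `e`.
  set c : α → ℕ := fun x ↦ if x ∈ M.loops ∪ T then f x else f e with hc
  refine ⟨c, ?_, ?_⟩
  · have himg : c '' M.E = f '' (M.loops ∪ T) := by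
      ext k
      constructor
      · rintro ⟨x, -, rfl⟩
        by_cases hx : x ∈ M.loops ∪ T
        · exact ⟨x, hx, (if_pos hx).symm⟩
        · exact ⟨e, Or.inr he, (if_neg hx).symm⟩
      · rintro ⟨x, hx, rfl⟩
        exact ⟨x, hsub hx, if_pos hx⟩
    rw [himg, (hf.mono hsub).ncard_image, Set.ncard_union_eq _ hLfin hTfin, hT]
    exact (Set.disjoint_sdiff_right (s := M.loops) (t := M.E)).mono_right hTsub
  · rintro ⟨B, hB, hdis⟩
    have hmono : ∀ x, M.IsNonloop x → x ∉ T \ {e} → c x = f e := by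
      intro x hx hxT
      by_cases hxe : x = e
      · rw [hxe]
        exact if_pos (Or.inr he)
      · refine if_neg ?_
        rintro (h | h)
        · exact (Matroid.isNonloop_iff_mem_compl_loops.1 hx).2 h
        · exact hxT ⟨h, hxe⟩
    have h2 := mul_le_ncard_of_pairwise_disjoint (k := 1) (U := T \ {e}) hTfin.sdiff hdis
      (fun i ↦ by
        refine (Set.ncard_pos (hTfin.sdiff.subset Set.inter_subset_right)).2 ?_
        by_contra hemp
        rw [Set.not_nonempty_iff_eq_empty] at hemp
        have hall : ∀ x ∈ B i, c x = f e := fun x hx ↦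
          hmono x ((hB i).1.indep.isNonloop_of_mem hx) fun h ↦ by
            have : x ∈ B i ∩ (T \ {e}) := ⟨hx, h⟩
            rw [hemp] at this
            exact this
        have hss : (B i).encard ≤ 1 := Set.encard_le_one_iff.2
          fun x y hx hy ↦ (hB i).2 hx hy ((hall x hx).trans (hall y hy).symm)
        rw [(hB i).1.encard_eq_eRank, hM] at hss
        exact absurd hss (by decide))
    have h3 := Set.ncard_sdiff_singleton_add_one he hTfin
    omega

theorem mainTheorem2 {α : Type*} (M : Matroid α) [M.Finite] (hM : M.eRank = 2)
    (t : ℕ) (ht : 1 ≤ t) :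
    ((M.E.ncard < M.loops.ncard + 2 * t ∨
        ∃ x ∈ M.E, M.E.ncard < (M.closure {x}).ncard + t) →
      M.IsAntiRamseyNumber t M.E.ncard) ∧
    (¬ (M.E.ncard < M.loops.ncard + 2 * t ∨
        ∃ x ∈ M.E, M.E.ncard < (M.closure {x}).ncard + t) →
      M.IsAntiRamseyNumber t (M.loops.ncard + t)) := by
  have hfin := M.ground_finite
  constructor
  · intro h
    refine ⟨?_, ?_⟩
    · obtain ⟨f, hf⟩ := Set.countable_iff_exists_injOn.1 hfin.countable
      refine ⟨f, hf.ncard_image, fun hR ↦ ?_⟩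
      obtain ⟨h1, h2⟩ := hR.le_ncard hM
      rcases h with h | ⟨x, -, h⟩
      · omega
      · have := h2 x
        omega
    · rintro k ⟨c, rfl, -⟩
      exact Set.ncard_image_le hfin
  · intro h
    push Not at h
    refine ⟨Matroid.exists_not_hasDisjointRainbowBases hM ht (by omega), ?_⟩
    rintro k ⟨c, rfl, hc⟩
    by_contra! hlt
    exact hc (Matroid.hasDisjointRainbowBases_of_lt_ncard hM h.1 h.2 hlt)
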